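/- Let $\mathcal A$ be a finite alphabet with the discrete topology and let $T$ denote the left shift $(x_n)_n\mapsto(x_{n+1})_n$ on $\mathcal A^{\mathbb N}$ and on $\mathcal A^{\mathbb Z}$, with the product topologies. Let $\tilde X\subseteq \mathcal A^{\mathbb N}$ be a one-sided minimal shift, that is, a non-empty closed set with $T(\tilde X)\subseteq\tilde X$ whose only closed $T$-invariant subsets are $\emptyset$ and $\tilde X$. Let $X\subseteq\mathcal A^{\mathbb Z}$ be its natural extension, that is, the two-sided shift consisting of all $x\in\mathcal A^{\mathbb Z}$ each of whose finite subwords is a subword of some point of $\tilde X$. For $Y\in\{\tilde X,X\}$, a number $\lambda\in\mathbb C$ is a continuous eigenvalue of $(Y,T)$ if there is a continuous function $f:Y\to\mathbb C$, $f\neq 0$, with $f\circ T=\lambda f$; let $E(Y,T)=\{t\in\mathbb R: e^{2\pi i t}\text{ is a continuous eigenvalue of }(Y,T)\}$. If $\rho$ is a $T$-invariant Borel probability measure on $Y$, a measurable eigenvalue of $(Y,T,\rho)$ is an eigenvalue of the operator $f\mapsto f\circ T$ on $L^2(Y,\rho)$ (complex-valued functions). For a finite word $w$ let $[w]=\{x: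 x_{[0,|w|)}=w\}$ denote the corresponding cylinder in $\tilde X$ or in $X$. Then: 1. $E(\tilde X,T)=E(X,T)$; moreover, $\lambda\in\mathbb C$ is a continuous eigenvalue of $(\tilde X,T)$ if and only if it is a continuous eigenvalue of $(X,T)$. 2. Let $\tilde\mu$ be a $T$-invariant Borel probability measure on $\tilde X$. There is exactly one $T$-invariant Borel probability measure $\mu$ on $X$ with $\mu([w])=\tilde\mu([w])$ for every finite word $w$ (the measure corresponding to $\tilde\mu$), and $\lambda\in\mathbb C$ is a measurable eigenvalue of $(\tilde X,T,\tilde\mu)$ if and only if it is a measurable eigenvalue of $(X,T,\mu)$. -/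

import Mathlib

open MeasureTheory

/-- The left shift `(x_n) ↦ (x_{n+1})` on sequences indexed by `N` (here `N = ℕ` or `N = ℤ`). -/
def shiftMap {N A : Type*} [AddMonoidWithOne N] (x : N → A) : N → A := fun n => x (n + 1)

/-- The subword `x_{[i, i+n)} = x_i x_{i+1} ⋯ x_{i+n-1}` of `x`. -/
def subword {N A : Type*} [AddMonoidWithOne N] (x : N → A) (i : N) (n : ℕ) : List A :=
  List.ofFn fun k : Fin n => x (i + ((k : ℕ) : N))

/-- A shift over `A`: a closed subset of `A^N` that is mapped into itself by the left shift. It is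
one-sided for `N = ℕ` and two-sided for `N = ℤ`. -/
structure ShiftSpace (N A : Type*) [AddMonoidWithOne N] [TopologicalSpace A] where
  carrier : Set (N → A)
  isClosed : IsClosed carrier
  mapsTo : Set.MapsTo shiftMap carrier carrier

namespace ShiftSpace

/-- The shift map `T : X → X`. -/
def T {N A : Type*} [AddMonoidWithOne N] [TopologicalSpace A] (X : ShiftSpace N A) :
    X.carrier → X.carrier :=
  X.mapsTo.restrict shiftMap X.carrier X.carrier

/-- A shift is minimal if it is non-empty and has no closed shift-invariant subset other than
`∅` and itself. -/
def IsMinimal {N A : Type*} [AddMonoidWithOne N] [TopologicalSpace A] (X : ShiftSpace N A) :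
    Prop :=
  X.carrier.Nonempty ∧ ∀ Y : ShiftSpace N A, Y.carrier ⊆ X.carrier →
    Y.carrier = ∅ ∨ Y.carrier = X.carrier

/-- The language of `X`: the set of all subwords of points of `X`. -/
def language {N A : Type*} [AddMonoidWithOne N] [TopologicalSpace A] (X : ShiftSpace N A) :
    Set (List A) :=
  {w | ∃ x ∈ X.carrier, ∃ (i : N) (n : ℕ), w = subword x i n}

/-- The cylinder `[w] = {x ∈ X | x_{[0,|w|)} = w}`. -/
def cylinder {N A : Type*} [AddMonoidWithOne N] [TopologicalSpace A] (X : ShiftSpace N A)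
    (w : List A) : Set X.carrier :=
  {x | subword x.1 0 w.length = w}

/-- The natural extension of a one-sided shift `X`: the two-sided shift defined by the language of
`X`, that is, the set of all two-sided sequences all of whose subwords belong to it. -/
def naturalExtension {A : Type*} [TopologicalSpace A] [DiscreteTopology A] (X : ShiftSpace ℕ A) :
    ShiftSpace ℤ A where
  carrier := {x | ∀ (i : ℤ) (n : ℕ), subword x i n ∈ X.language}
  isClosed := by
    simp only [Set.ofPred_forall]
    refine isClosed_iInter fun i => isClosed_iInter fun n => ?_
    have hc : Continuous fun x : ℤ → A => fun k : Fin n => x (i + ((k : ℕ) : ℤ)) := by fun_prop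
    exact (isClosed_discrete {v : Fin n → A | List.ofFn v ∈ X.language}).preimage hc
  mapsTo := by
    intro x hx i n
    have h : subword (shiftMap x) i n = subword x (i + 1) n := by
      simp only [subword, shiftMap, add_right_comm]
    rw [h]
    exact hx (i + 1) n

/-- `c` is a continuous eigenvalue of `(X, T)`: there is a continuous `f : X → ℂ`, not identically
zero, with `f ∘ T = c f`. -/
def IsContinuousEigenvalue {N A : Type*} [AddMonoidWithOne N] [TopologicalSpace A]
    (X : ShiftSpace N A) (c : ℂ) : Prop :=
  ∃ f : X.carrier → ℂ, Continuous f ∧ f ≠ 0 ∧ f ∘ X.T = c • f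

/-- `E(X, T)`: the set of additive continuous eigenvalues of `(X, T)`, the real numbers `t` such
that `e^{2πit}` is a continuous eigenvalue. -/
def E {N A : Type*} [AddMonoidWithOne N] [TopologicalSpace A] (X : ShiftSpace N A) : Set ℝ :=
  {t | X.IsContinuousEigenvalue (Complex.exp (2 * Real.pi * Complex.I * t))}

/-- `c` is a measurable eigenvalue of `(X, T, μ)`: an eigenvalue of the operator `f ↦ f ∘ T` on
`L²(X, μ)`. -/
def IsMeasurableEigenvalue {N A : Type*} [AddMonoidWithOne N] [TopologicalSpace A]
    [MeasurableSpace A] (X : ShiftSpace N A) (μ : Measure X.carrier)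
    (hμ : MeasurePreserving X.T μ μ) (c : ℂ) : Prop :=
  Module.End.HasEigenvalue
    (Lp.compMeasurePreservingₗ ℂ X.T hμ : Module.End ℂ (Lp ℂ 2 μ)) c

/-- `μ` is a measure on the natural extension of `X` that corresponds to the measure `ν` on `X`:
a shift-invariant probability measure that gives every cylinder `[w]` the mass that `ν` gives it. -/
structure IsCorrespondingMeasure {A : Type*} [TopologicalSpace A] [DiscreteTopology A]
    [MeasurableSpace A] (X : ShiftSpace ℕ A) (ν : Measure X.carrier)
    (μ : Measure X.naturalExtension.carrier) : Prop where
  isProbabilityMeasure : IsProbabilityMeasure μ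
  measurePreserving : MeasurePreserving X.naturalExtension.T μ μ
  cylinder_eq : ∀ w : List A, μ (X.naturalExtension.cylinder w) = ν (X.cylinder w)

end ShiftSpace

/-! The natural extension is the inverse limit of `X ← X ← ⋯` with bonding map `T`: the tail maps `x
↦ x_{-m} x_{-m+1} ⋯` satisfy `T ∘ tail (m+1) = tail m = tail (m+1) ∘ T`. Eigenfunctions on `X` pull
back along `tail 0`; the point is that every eigenfunction upstairs factors through `tail 0`.

Continuous case (`eq_of_tail_zero_eq`): the eigenvalue has modulus one, so `‖f (T^n x) - f (T^n y)‖`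
does not depend on `n`. If `x` and `y` have the same nonnegative coordinates, their orbits are
asymptotic and compactness forces `f x = f y`. Minimality makes `T` surjective on `X`, hence `tail
0` a quotient map, and `f` descends.

Measurable case (`hasEigenvalue_iff_of_tower`): functions of some `tail m` are dense in `L²`. The
isometry `c⁻ᵐ Uᵐ` fixes the eigenfunction and carries functions of `tail m` to functions of `tail
0`, so the eigenfunction lies in the closed subspace of the latter.

A measure corresponds to `ν` exactly when every tail map sends it to `ν`. Uniqueness follows because
the tails generate the σ-algebra, existence from weak compactness of the probability measures on
`A^ℤ`. -/

/-! ### Measures on inverse limits -/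

section Tower

variable {Y : Type*} {Z : ℕ → Type*} [∀ m, MeasurableSpace (Z m)]

/-- The sets which are preimages of measurable sets under one of the maps `r m`. -/
def towerSets (r : ∀ m, Y → Z m) : Set (Set Y) :=
  {t | ∃ (m : ℕ) (D : Set (Z m)), MeasurableSet D ∧ t = r m ⁻¹' D}

variable {r : ∀ m, Y → Z m} {φ : ∀ m, Z (m + 1) → Z m}

theorem exists_preimage_of_le (hφ : ∀ m, Measurable (φ m)) (hr : ∀ m, φ m ∘ r (m + 1) = r m)
    {m n : ℕ} (hmn : m ≤ n) {D : Set (Z m)} (hD : MeasurableSet D) :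
    ∃ D' : Set (Z n), MeasurableSet D' ∧ r m ⁻¹' D = r n ⁻¹' D' := by
  induction n, hmn using Nat.le_induction with
  | base => exact ⟨D, hD, rfl⟩
  | succ n _ ih =>
    obtain ⟨D', hD', h⟩ := ih
    exact ⟨φ n ⁻¹' D', hφ n hD', by rw [h, ← hr n]; rfl⟩

theorem isSetAlgebra_towerSets (hφ : ∀ m, Measurable (φ m)) (hr : ∀ m, φ m ∘ r (m + 1) = r m) :
    IsSetAlgebra (towerSets r) where
  empty_mem := ⟨0, ∅, .empty, rfl⟩
  compl_mem := by
    rintro _ ⟨m, D, hD, rfl⟩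
    exact ⟨m, Dᶜ, hD.compl, rfl⟩
  union_mem := by
    rintro _ _ ⟨m, D, hD, rfl⟩ ⟨n, E, hE, rfl⟩
    obtain ⟨D', hD', h⟩ := exists_preimage_of_le hφ hr (le_max_left m n) hD
    obtain ⟨E', hE', h'⟩ := exists_preimage_of_le hφ hr (le_max_right m n) hE
    exact ⟨max m n, D' ∪ E', hD'.union hE', by rw [h, h']; rfl⟩

theorem eq_generateFrom_towerSets [mY : MeasurableSpace Y] (hrm : ∀ m, Measurable (r m))
    (hgen : mY ≤ ⨆ m, MeasurableSpace.comap (r m) inferInstance) :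
    mY = MeasurableSpace.generateFrom (towerSets r) := by
  refine le_antisymm (hgen.trans (iSup_le fun m => ?_)) (MeasurableSpace.generateFrom_le ?_)
  · rintro _ ⟨D, hD, rfl⟩
    exact MeasurableSpace.measurableSet_generateFrom ⟨m, D, hD, rfl⟩
  · rintro _ ⟨m, D, hD, rfl⟩
    exact hrm m hD

/-- Finite measures on the limit of a tower are determined by their images in the tower. -/
theorem measure_ext_of_tower [mY : MeasurableSpace Y] (hrm : ∀ m, Measurable (r m))
    (hφ : ∀ m, Measurable (φ m)) (hr : ∀ m, φ m ∘ r (m + 1) = r m)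
    (hgen : mY ≤ ⨆ m, MeasurableSpace.comap (r m) inferInstance)
    {μ₁ μ₂ : Measure Y} [IsFiniteMeasure μ₁] (h : ∀ m, μ₁.map (r m) = μ₂.map (r m)) :
    μ₁ = μ₂ := by
  have key : ∀ s ∈ towerSets r, μ₁ s = μ₂ s := by
    rintro _ ⟨m, D, hD, rfl⟩
    rw [← Measure.map_apply (hrm m) hD, h m, Measure.map_apply (hrm m) hD]
  have halg := isSetAlgebra_towerSets hφ hr
  exact ext_of_generate_finite _ (eq_generateFrom_towerSets hrm hgen)
    (fun s hs t ht _ => halg.inter_mem hs ht) key (key _ halg.univ_mem)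

end Tower

theorem compMeasurePreservingₗ_comp_apply {X Y Z : Type*} [MeasurableSpace X] [MeasurableSpace Y]
    [MeasurableSpace Z] {μ : Measure X} {ν : Measure Y} {ρ : Measure Z} {f : X → Y} {g : Y → Z}
    {k : X → Z} (hf : MeasurePreserving f μ ν) (hg : MeasurePreserving g ν ρ)
    (hk : MeasurePreserving k μ ρ) (h : g ∘ f = k) (x : Lp ℂ 2 ρ) :
    Lp.compMeasurePreservingₗ ℂ f hf (Lp.compMeasurePreservingₗ ℂ g hg x) =
      Lp.compMeasurePreservingₗ ℂ k hk x := by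
  subst h
  exact (Lp.compMeasurePreserving_comp_apply x hg hf).symm

/-! ### Eigenvalues on `L²` of an inverse limit -/

section Eigenvalue

variable {Y Z : Type*} [mY : MeasurableSpace Y] [mZ : MeasurableSpace Z] {μ : Measure Y}
  {ν : Measure Z} {r : ℕ → Y → Z} {S : Z → Z} {T : Y → Y}

/-- The functions in `L²` that factor through one of the maps of a generating tower are dense. -/
theorem topologicalClosure_iSup_range_eq_top [IsFiniteMeasure μ]
    (hS : MeasurePreserving S ν ν) (hrm : ∀ m, MeasurePreserving (r m) μ ν)
    (hr : ∀ m, S ∘ r (m + 1) = r m) (hgen : mY ≤ ⨆ m, mZ.comap (r m)) :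
    (⨆ m, LinearMap.range
      (Lp.compMeasurePreservingₗ ℂ (r m) (hrm m) : Lp ℂ 2 ν →ₗ[ℂ] Lp ℂ 2 μ)).topologicalClosure
        = ⊤ := by
  have hdense : μ.MeasureDense (towerSets r) :=
    Measure.MeasureDense.of_generateFrom_isSetAlgebra_finite μ
      (isSetAlgebra_towerSets (fun _ => hS.measurable) hr)
      (eq_generateFrom_towerSets (fun m => (hrm m).measurable) hgen)
  have : Fact ((2 : ENNReal) ≠ ⊤) := ⟨ENNReal.ofNat_ne_top⟩
  rw [eq_top_iff]
  rintro f -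
  refine Lp.induction ENNReal.ofNat_ne_top (fun f => f ∈ (⨆ m, LinearMap.range
      (Lp.compMeasurePreservingₗ ℂ (r m) (hrm m) : Lp ℂ 2 ν →ₗ[ℂ] Lp ℂ 2 μ)).topologicalClosure)
    ?_ ?_ ?_ f
  · intro c s hs hμs
    refine closure_mono ?_ (hdense.indicatorConstLp_subset_closure 2 c ⟨s, hs, hμs.ne, rfl⟩)
    rintro _ ⟨_, ⟨m, D, hD, rfl⟩, hfin, rfl⟩
    refine (le_iSup (fun m => LinearMap.range
      (Lp.compMeasurePreservingₗ ℂ (r m) (hrm m) : Lp ℂ 2 ν →ₗ[ℂ] Lp ℂ 2 μ)) m) ?_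
    have hD' : ν D ≠ ⊤ := by rwa [← (hrm m).measure_preimage hD.nullMeasurableSet]
    exact ⟨indicatorConstLp 2 hD hD' c, Lp.indicatorConstLp_compMeasurePreserving hD hD' c (hrm m)⟩
  · exact fun f g hf hg _ h₁ h₂ => add_mem h₁ h₂
  · exact Submodule.isClosed_topologicalClosure _

/-- If a system `(Y, T, μ)` is generated by a tower of factor maps onto `(Z, S, ν)`, then both
systems have the same eigenvalues. -/
theorem hasEigenvalue_iff_of_tower [IsFiniteMeasure μ] (hT : MeasurePreserving T μ μ)
    (hS : MeasurePreserving S ν ν) (hrm : ∀ m, MeasurePreserving (r m) μ ν)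
    (hr : ∀ m, S ∘ r (m + 1) = r m) (hrT : ∀ m, r (m + 1) ∘ T = r m)
    (hgen : mY ≤ ⨆ m, mZ.comap (r m)) (c : ℂ) :
    Module.End.HasEigenvalue (Lp.compMeasurePreservingₗ ℂ S hS : Module.End ℂ (Lp ℂ 2 ν)) c ↔
      Module.End.HasEigenvalue (Lp.compMeasurePreservingₗ ℂ T hT : Module.End ℂ (Lp ℂ 2 μ)) c := by
  let V : Module.End ℂ (Lp ℂ 2 ν) := Lp.compMeasurePreservingₗ ℂ S hS
  let U : Module.End ℂ (Lp ℂ 2 μ) := Lp.compMeasurePreservingₗ ℂ T hT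
  let R : ℕ → Lp ℂ 2 ν →ₗᵢ[ℂ] Lp ℂ 2 μ := fun m => Lp.compMeasurePreservingₗᵢ ℂ (r m) (hrm m)
  have hRV (m : ℕ) (g : Lp ℂ 2 ν) : R (m + 1) (V g) = R m g :=
    compMeasurePreservingₗ_comp_apply _ _ _ (hr m) g
  have hUR (m : ℕ) (g : Lp ℂ 2 ν) : U (R (m + 1) g) = R m g :=
    compMeasurePreservingₗ_comp_apply _ _ _ (hrT m) g
  have hUR0 (g : Lp ℂ 2 ν) : U (R 0 g) = R 0 (V g) := by rw [← hRV 0, hUR]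
  have hUn (m : ℕ) (g : Lp ℂ 2 ν) : (U ^ m) (R m g) = R 0 g := by
    induction m with
    | zero => rfl
    | succ m ih => rw [pow_succ, Module.End.mul_apply, hUR, ih]
  change V.HasEigenvalue c ↔ U.HasEigenvalue c
  constructor
  · intro h
    obtain ⟨g, hg⟩ := h.exists_hasEigenvector
    refine Module.End.hasEigenvalue_of_hasEigenvector (x := R 0 g)
      (Module.End.hasEigenvector_iff.2 ⟨Module.End.mem_eigenspace_iff.2 ?_, ?_⟩)
    · rw [hUR0, hg.apply_eq_smul, map_smul]
    · exact fun h0 => hg.2 ((R 0).injective (h0.trans (map_zero _).symm))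
  · intro h
    obtain ⟨f, hf⟩ := h.exists_hasEigenvector
    have hUnorm (x : Lp ℂ 2 μ) : ‖U x‖ = ‖x‖ := Lp.norm_compMeasurePreserving x hT
    have hUnorm' (m : ℕ) (x : Lp ℂ 2 μ) : ‖(U ^ m) x‖ = ‖x‖ := by
      induction m with
      | zero => rfl
      | succ m ih => rw [pow_succ', Module.End.mul_apply, hUnorm, ih]
    have hc : ‖c‖ = 1 := by
      have h1 := hUnorm f
      rw [hf.apply_eq_smul, norm_smul] at h1
      exact (mul_eq_right₀ (norm_ne_zero_iff.2 hf.2)).1 h1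
    have hc0 : c ≠ 0 := norm_ne_zero_iff.1 (by simp [hc])
    have hmem : f ∈ Set.range (R 0) := by
      -- An isometric image of the complete space `L²` is closed, so approximating `f` by functions
      -- of `r 0` is enough.
      rw [← (R 0).isometry.isClosedEmbedding.isClosed_range.closure_eq, Metric.mem_closure_iff]
      intro ε hε
      have hfd : f ∈ closure ((⨆ m, LinearMap.range (Lp.compMeasurePreservingₗ ℂ (r m) (hrm m) :
          Lp ℂ 2 ν →ₗ[ℂ] Lp ℂ 2 μ) : Submodule ℂ (Lp ℂ 2 μ)) : Set (Lp ℂ 2 μ)) := by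
        rw [← Submodule.topologicalClosure_coe,
          topologicalClosure_iSup_range_eq_top hS hrm hr hgen]
        trivial
      obtain ⟨k, hk, hfk⟩ := Metric.mem_closure_iff.1 hfd ε hε
      have hmono : Monotone fun m => LinearMap.range (Lp.compMeasurePreservingₗ ℂ (r m) (hrm m) :
          Lp ℂ 2 ν →ₗ[ℂ] Lp ℂ 2 μ) := monotone_nat_of_le_succ fun m => by
        rintro _ ⟨g, rfl⟩
        exact ⟨V g, hRV m g⟩
      obtain ⟨m, g, rfl⟩ := (Submodule.mem_iSup_of_directed _ hmono.directed_le).1 hk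
      change dist f (R m g) < ε at hfk
      -- This is the image of `R m g` under the isometry `c⁻ᵐ Uᵐ`, which fixes `f`; the distance to
      -- `f` is unchanged.
      refine ⟨R 0 ((c ^ m)⁻¹ • g), ⟨_, rfl⟩, ?_⟩
      have hcf : (c ^ m)⁻¹ • (U ^ m) f = f := by
        rw [hf.pow_apply, smul_smul, inv_mul_cancel₀ (pow_ne_zero m hc0), one_smul]
      have : f - R 0 ((c ^ m)⁻¹ • g) = (c ^ m)⁻¹ • (U ^ m) (f - R m g) := by
        rw [map_sub, smul_sub, hcf, hUn, map_smul]
      rwa [dist_eq_norm, this, norm_smul, hUnorm', norm_inv, norm_pow, hc, one_pow, inv_one,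
        one_mul, ← dist_eq_norm]
    obtain ⟨g, rfl⟩ := hmem
    refine Module.End.hasEigenvalue_of_hasEigenvector (x := g)
      (Module.End.hasEigenvector_iff.2 ⟨Module.End.mem_eigenspace_iff.2 ?_, ?_⟩)
    · apply (R 0).injective
      rw [← hUR0, hf.apply_eq_smul, map_smul]
    · rintro rfl
      exact hf.2 (map_zero _)

end Eigenvalue

/-! ### One-sided tails of two-sided sequences -/

section Tail

variable {A : Type*}

/-- The one-sided sequence `x_{-m} x_{-m+1} ⋯`. -/
def tailFrom (m : ℕ) (x : ℤ → A) : ℕ → A := fun k => x (k - m)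

theorem shiftMap_tailFrom_succ (m : ℕ) (x : ℤ → A) :
    shiftMap (tailFrom (m + 1) x) = tailFrom m x := by
  funext k
  simp only [shiftMap, tailFrom]
  congr 1
  push_cast
  ring

theorem tailFrom_succ_shiftMap (m : ℕ) (x : ℤ → A) :
    tailFrom (m + 1) (shiftMap x) = tailFrom m x := by
  funext k
  simp only [shiftMap, tailFrom]
  congr 1
  push_cast
  ring

theorem tailFrom_shiftMap (m : ℕ) (x : ℤ → A) :
    tailFrom m (shiftMap x) = shiftMap (tailFrom m x) := by
  rw [← shiftMap_tailFrom_succ m (shiftMap x), tailFrom_succ_shiftMap]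

theorem subword_tailFrom_zero (x : ℤ → A) (n : ℕ) :
    subword (tailFrom 0 x) 0 n = subword x 0 n := by
  simp [subword, tailFrom]

theorem continuous_tailFrom [TopologicalSpace A] (m : ℕ) :
    Continuous (tailFrom m : (ℤ → A) → ℕ → A) :=
  continuous_pi fun k => continuous_apply ((k : ℤ) - m)

theorem continuous_shiftMap {N : Type*} [AddMonoidWithOne N] [TopologicalSpace A] :
    Continuous (shiftMap : (N → A) → N → A) :=
  continuous_pi fun k => continuous_apply (k + 1)

theorem measurable_tailFrom [MeasurableSpace A] (m : ℕ) :
    Measurable (tailFrom m : (ℤ → A) → ℕ → A) :=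
  measurable_pi_lambda _ fun k => measurable_pi_apply ((k : ℤ) - m)

theorem measurable_shiftMap {N : Type*} [AddMonoidWithOne N] [MeasurableSpace A] :
    Measurable (shiftMap : (N → A) → N → A) :=
  measurable_pi_lambda _ fun k => measurable_pi_apply (k + 1)

end Tail

/-! ### The natural extension as an inverse limit, and continuous eigenvalues -/

namespace ShiftSpace

theorem compactSpace_carrier {N A : Type*} [AddMonoidWithOne N] [TopologicalSpace A] [Finite A]
    (X : ShiftSpace N A) : CompactSpace X.carrier :=
  isCompact_iff_compactSpace.1 X.isClosed.isCompact

section NaturalExtension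

variable {A : Type*} [TopologicalSpace A]

theorem iterate_shiftMap_mem (X : ShiftSpace ℕ A) {x : ℕ → A} (hx : x ∈ X.carrier) (i : ℕ) :
    (fun k => x (i + k)) ∈ X.carrier := by
  induction i with
  | zero => simpa using hx
  | succ i ih =>
    convert X.mapsTo ih using 2 with k
    exact congrArg x (by ring)

/-- Points all of whose prefixes belong to the language of a one-sided shift lie in the shift. -/
theorem mem_of_subword_mem_language [DiscreteTopology A] (X : ShiftSpace ℕ A) {x : ℕ → A}
    (hx : ∀ n, subword x 0 n ∈ X.language) : x ∈ X.carrier := by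
  choose y hy i n hn using hx
  have hlen (N : ℕ) : n N = N := by
    have := congrArg List.length (hn N)
    simpa [subword] using this.symm
  have heq (N k : ℕ) (hk : k < N) : y N (i N + k) = x k := by
    have h := hn N
    rw [hlen N] at h
    have h' := congrFun (List.ofFn_injective h) ⟨k, hk⟩
    simpa using h'.symm
  -- The shifted points agree with `x` on the first `N` coordinates, so they converge to `x` inside
  -- the closed set.
  refine X.isClosed.mem_of_tendsto (f := fun N k => y N (i N + k)) (b := Filter.atTop) ?_
    (.of_forall fun N => X.iterate_shiftMap_mem (hy N) (i N))
  refine tendsto_pi_nhds.2 fun k => tendsto_const_nhds.congr' ?_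
  filter_upwards [Filter.eventually_gt_atTop k] with N hN using (heq N k hN).symm

theorem mem_naturalExtension_iff [DiscreteTopology A] (X : ShiftSpace ℕ A) (x : ℤ → A) :
    x ∈ X.naturalExtension.carrier ↔ ∀ m, tailFrom m x ∈ X.carrier := by
  constructor
  · intro hx m
    refine X.mem_of_subword_mem_language fun n => ?_
    have : subword (tailFrom m x) 0 n = subword x (-m) n := by
      simp only [subword, tailFrom]
      congr 1
      funext k
      congr 1
      push_cast
      ring
    rw [this]
    exact hx _ _
  · intro hx i n
    -- Position `i` of `x` is position `i + |i| ≥ 0` of the tail starting at `-|i|`.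
    refine ⟨_, hx i.natAbs, (i + i.natAbs).toNat, n, ?_⟩
    simp only [subword, tailFrom]
    congr 1
    funext k
    congr 1
    simp only [Nat.cast_id]
    omega

variable [DiscreteTopology A]

/-- The map `x ↦ x_{-m} x_{-m+1} ⋯` from the natural extension of a one-sided shift to the shift. -/
def tail (X : ShiftSpace ℕ A) (m : ℕ) (x : X.naturalExtension.carrier) : X.carrier :=
  ⟨tailFrom m x.1, (X.mem_naturalExtension_iff _).1 x.2 m⟩

theorem T_comp_tail_succ (X : ShiftSpace ℕ A) (m : ℕ) : X.T ∘ X.tail (m + 1) = X.tail m :=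
  funext fun x => Subtype.ext (shiftMap_tailFrom_succ m x.1)

theorem tail_succ_comp_T (X : ShiftSpace ℕ A) (m : ℕ) :
    X.tail (m + 1) ∘ X.naturalExtension.T = X.tail m :=
  funext fun x => Subtype.ext (tailFrom_succ_shiftMap m x.1)

theorem tail_comp_T (X : ShiftSpace ℕ A) (m : ℕ) :
    X.tail m ∘ X.naturalExtension.T = X.T ∘ X.tail m :=
  funext fun x => Subtype.ext (tailFrom_shiftMap m x.1)

theorem continuous_tail (X : ShiftSpace ℕ A) (m : ℕ) : Continuous (X.tail m) :=
  ((continuous_tailFrom m).comp continuous_subtype_val).subtype_mk _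

theorem T_naturalExtension_surjective (X : ShiftSpace ℕ A) :
    Function.Surjective X.naturalExtension.T := by
  intro x
  have h (m : ℕ) : tailFrom m (fun i => x.1 (i - 1)) = tailFrom (m + 1) x.1 := by
    funext k
    exact congrArg x.1 (by push_cast; ring)
  refine ⟨⟨fun i => x.1 (i - 1), (X.mem_naturalExtension_iff _).2 fun m => ?_⟩, Subtype.ext ?_⟩
  · rw [h]
    exact (X.mem_naturalExtension_iff _).1 x.2 (m + 1)
  · funext i
    exact congrArg x.1 (add_sub_cancel_right i 1)

theorem preimage_tail_zero_cylinder (X : ShiftSpace ℕ A) (w : List A) :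
    X.tail 0 ⁻¹' X.cylinder w = X.naturalExtension.cylinder w := by
  ext x
  change subword (tailFrom 0 x.1) 0 w.length = w ↔ subword x.1 0 w.length = w
  rw [subword_tailFrom_zero]

/-- The image of `T` is compact, invariant and non-empty, so minimality makes it everything. -/
theorem IsMinimal.T_surjective [Finite A] {X : ShiftSpace ℕ A} (hX : X.IsMinimal) :
    Function.Surjective X.T := by
  have hsub : shiftMap '' X.carrier ⊆ X.carrier := X.mapsTo.image_subset
  let Y : ShiftSpace ℕ A :=
    { carrier := shiftMap '' X.carrier
      isClosed := (X.isClosed.isCompact.image continuous_shiftMap).isClosed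
      mapsTo := fun x hx => ⟨x, hsub hx, rfl⟩ }
  have hY : shiftMap '' X.carrier = X.carrier :=
    (hX.2 Y hsub).resolve_left (hX.1.image _).ne_empty
  rintro ⟨y, hy⟩
  obtain ⟨x, hx, rfl⟩ := hY.ge hy
  exact ⟨⟨x, hx⟩, rfl⟩

/-- Iterated preimages `z m` of `y`, with `T (z (m+1)) = z m`, prolong `y` to the left one letter at
a time. -/
theorem tail_zero_surjective {X : ShiftSpace ℕ A} (hT : Function.Surjective X.T) :
    Function.Surjective (X.tail 0) := by
  intro y
  obtain ⟨g, hg⟩ := hT.hasRightInverse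
  let z : ℕ → X.carrier := fun m => g^[m] y
  have hz (m j : ℕ) : (z (m + j)).1 j = (z m).1 0 := by
    induction j with
    | zero => rfl
    | succ j ih =>
      have : X.T (z (m + (j + 1))) = z (m + j) := by
        simp only [z, ← add_assoc, Function.iterate_succ_apply', hg _]
      rw [← ih, ← this]
      rfl
  have hz' (m k : ℕ) (h : m ≤ k) : (z m).1 k = (z 0).1 (k - m) := by
    induction m generalizing k with
    | zero => rfl
    | succ m ih =>
      obtain ⟨k, rfl⟩ : ∃ j, k = j + 1 := ⟨k - 1, by omega⟩
      have : X.T (z (m + 1)) = z m := by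
        simp only [z, Function.iterate_succ_apply', hg _]
      rw [Nat.add_sub_add_right, ← ih k (by omega), ← this]
      rfl
  -- Since `toNat` truncates at `0`, coordinate `i` is `y_i` for `i ≥ 0` and the first letter of `z
  -- (-i)` for `i < 0`.
  have key (m : ℕ) : tailFrom m (fun i => (z (-i).toNat).1 i.toNat) = (z m).1 := by
    funext k
    simp only [tailFrom]
    rcases le_total m k with h | h
    · rw [hz' m k h, show (-((k : ℤ) - m)).toNat = 0 by omega,
        show ((k : ℤ) - m).toNat = k - m by omega]
    · obtain ⟨j, rfl⟩ := Nat.exists_eq_add_of_le h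
      rw [show (-((k : ℤ) - (k + j : ℕ))).toNat = j by omega,
        show ((k : ℤ) - (k + j : ℕ)).toNat = 0 by omega, add_comm k j, hz]
  refine ⟨⟨fun i => (z (-i).toNat).1 i.toNat, (X.mem_naturalExtension_iff _).2 fun m => ?_⟩,
    Subtype.ext (key 0)⟩
  rw [key]
  exact (z m).2

/-- At a maximum point of `‖f‖`, going forward gives `‖c‖ ≤ 1` and going back to a preimage gives
`‖c‖ ≥ 1`. -/
theorem norm_eq_one_of_comp_eq_smul {K : Type*} [TopologicalSpace K] [CompactSpace K] {T : K → K}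
    (hT : Function.Surjective T) {f : K → ℂ} (hf : Continuous f) (hf0 : f ≠ 0) {c : ℂ}
    (h : f ∘ T = c • f) : ‖c‖ = 1 := by
  obtain ⟨x₀, hx₀⟩ := Function.ne_iff.1 hf0
  have : Nonempty K := ⟨x₀⟩
  obtain ⟨x, -, hx⟩ := isCompact_univ.exists_isMaxOn Set.univ_nonempty hf.norm.continuousOn
  have hmax (y : K) : ‖f y‖ ≤ ‖f x‖ := hx (Set.mem_univ y)
  have hpos : 0 < ‖f x‖ := (norm_pos_iff.2 hx₀).trans_le (hmax x₀)
  have hmul (y : K) : ‖f (T y)‖ = ‖c‖ * ‖f y‖ := by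
    rw [← norm_mul]
    exact congrArg norm (congrFun h y)
  obtain ⟨y, hy⟩ := hT x
  apply le_antisymm
  · have := hmul x ▸ hmax (T x)
    nlinarith
  · have h1 := hmul y
    rw [hy] at h1
    nlinarith [hmax y, norm_nonneg c]

/-- A continuous eigenfunction of the natural extension only depends on the coordinates with
nonnegative indices. -/
theorem eq_of_tail_zero_eq [Finite A] {X : ShiftSpace ℕ A} {f : X.naturalExtension.carrier → ℂ}
    (hf : Continuous f) {c : ℂ} (hc : ‖c‖ = 1) (h : f ∘ X.naturalExtension.T = c • f)
    {x y : X.naturalExtension.carrier} (hxy : X.tail 0 x = X.tail 0 y) : f x = f y := by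
  have := X.naturalExtension.compactSpace_carrier
  let T := X.naturalExtension.T
  have hfn (n : ℕ) (z : X.naturalExtension.carrier) : f (T^[n] z) = c ^ n * f z := by
    induction n with
    | zero => simp
    | succ n ih =>
      have h1 : f (T (T^[n] z)) = c * f (T^[n] z) := congrFun h _
      rw [Function.iterate_succ_apply', h1, ih, pow_succ']
      ring
  have hTn (n : ℕ) (z : X.naturalExtension.carrier) (i : ℤ) : (T^[n] z).1 i = z.1 (i + n) := by
    induction n generalizing i with
    | zero => simp
    | succ n ih =>
      have h1 : (T (T^[n] z)).1 i = (T^[n] z).1 (i + 1) := rfl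
      rw [Function.iterate_succ_apply', h1, ih]
      exact congrArg z.1 (by push_cast; ring)
  -- Closed conditions that eventually hold along the orbit of `(x, y)` pass to a cluster point `(p,
  -- q)`: each coordinate eventually agrees, so `p = q`, while `‖f p - f q‖ = ‖f x - f y‖`.
  obtain ⟨⟨p, q⟩, hpq⟩ := exists_clusterPt_of_compactSpace
    (Filter.map (fun n : ℕ => (T^[n] x, T^[n] y)) Filter.atTop)
  have hclosed {s : Set (X.naturalExtension.carrier × X.naturalExtension.carrier)}
      (hs : IsClosed s) (hev : ∀ᶠ n : ℕ in Filter.atTop, (T^[n] x, T^[n] y) ∈ s) : (p, q) ∈ s :=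
    isClosed_iff_clusterPt.1 hs _ (hpq.mono (Filter.le_principal_iff.2 hev))
  have hpq' : p = q := by
    refine Subtype.ext (funext fun i => ?_)
    refine hclosed (s := {z | z.1.1 i = z.2.1 i}) (isClosed_eq ?_ ?_) ?_
    · exact (continuous_apply i).comp (continuous_subtype_val.comp continuous_fst)
    · exact (continuous_apply i).comp (continuous_subtype_val.comp continuous_snd)
    · filter_upwards [Filter.eventually_ge_atTop i.natAbs] with n hn
      rw [hTn, hTn]
      have h1 : x.1 _ = y.1 _ := congrFun (congrArg Subtype.val hxy) (i + n).toNat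
      have h2 : (((i + n).toNat : ℕ) : ℤ) - ((0 : ℕ) : ℤ) = i + n := by
        push_cast
        omega
      rwa [h2] at h1
  have hdist : ‖f p - f q‖ = ‖f x - f y‖ := by
    refine hclosed (s := {z | ‖f z.1 - f z.2‖ = ‖f x - f y‖}) (isClosed_eq ?_ continuous_const) ?_
    · exact ((hf.comp continuous_fst).sub (hf.comp continuous_snd)).norm
    · refine .of_forall fun n => ?_
      change ‖f (T^[n] x) - f (T^[n] y)‖ = _
      rw [hfn, hfn, ← mul_sub, norm_mul, norm_pow, hc, one_pow, one_mul]
  rw [hpq', sub_self, norm_zero] at hdist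
  exact sub_eq_zero.1 (norm_eq_zero.1 hdist.symm)

theorem isContinuousEigenvalue_naturalExtension_iff [Finite A] {X : ShiftSpace ℕ A}
    (hT : Function.Surjective X.T) (c : ℂ) :
    X.naturalExtension.IsContinuousEigenvalue c ↔ X.IsContinuousEigenvalue c := by
  have hsurj := tail_zero_surjective hT
  constructor
  · rintro ⟨f, hf, hf0, h⟩
    have := X.naturalExtension.compactSpace_carrier
    have hc := norm_eq_one_of_comp_eq_smul X.T_naturalExtension_surjective hf hf0 h
    obtain ⟨s, hs⟩ := hsurj.hasRightInverse
    have hfs : (f ∘ s) ∘ X.tail 0 = f :=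
      funext fun x => eq_of_tail_zero_eq hf hc h (hs (X.tail 0 x))
    refine ⟨f ∘ s, ?_, ?_, ?_⟩
    · refine ((X.continuous_tail 0).isClosedMap.isQuotientMap (X.continuous_tail 0)
        hsurj).continuous_iff.2 ?_
      rwa [hfs]
    · intro h0
      rw [h0] at hfs
      exact hf0 hfs.symm
    · refine hsurj.injective_comp_right ?_
      change (f ∘ s) ∘ X.T ∘ X.tail 0 = c • ((f ∘ s) ∘ X.tail 0)
      rw [← tail_comp_T, ← Function.comp_assoc, hfs, h]
  · rintro ⟨f, hf, hf0, h⟩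
    refine ⟨f ∘ X.tail 0, hf.comp (X.continuous_tail 0), ?_, ?_⟩
    · intro h0
      exact hf0 (hsurj.injective_comp_right h0)
    · rw [Function.comp_assoc, tail_comp_T, ← Function.comp_assoc, h]
      rfl

end NaturalExtension

end ShiftSpace

/-! ### Corresponding measures and measurable eigenvalues -/

theorem measurableSpace_pi_le_iSup_comap_tailFrom {A : Type*} [MeasurableSpace A] :
    (inferInstance : MeasurableSpace (ℤ → A)) ≤
      ⨆ m, MeasurableSpace.comap (tailFrom m) inferInstance := by
  refine iSup_le fun i => ?_
  refine le_trans ?_ (le_iSup _ i.natAbs)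
  have : (fun x : ℤ → A => x i) =
      (fun y : ℕ → A => y (i + i.natAbs).toNat) ∘ tailFrom i.natAbs := by
    funext x
    refine congrArg x ?_
    omega
  rw [this, ← MeasurableSpace.comap_comp]
  exact MeasurableSpace.comap_mono (measurable_pi_apply _).comap_le

/-- Probability measures on one-sided sequences that are shift-invariant extend to two-sided
sequences: there is a measure whose images under all the tail maps are the given measure. -/
theorem exists_measure_map_tailFrom_eq {A : Type*} [Finite A] [TopologicalSpace A]
    [DiscreteTopology A] [MeasurableSpace A] [BorelSpace A] (ν : Measure (ℕ → A))
    [IsProbabilityMeasure ν] (hν : MeasurePreserving shiftMap ν ν) :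
    ∃ P : Measure (ℤ → A), IsProbabilityMeasure P ∧ ∀ m, P.map (tailFrom m) = ν := by
  let ν' : ProbabilityMeasure (ℕ → A) := ⟨ν, inferInstance⟩
  let F (m : ℕ) : Set (ProbabilityMeasure (ℤ → A)) :=
    {P | P.map (continuous_tailFrom m).measurable.aemeasurable = ν'}
  have hF (m : ℕ) (P : ProbabilityMeasure (ℤ → A)) :
      P ∈ F m ↔ (P : Measure (ℤ → A)).map (tailFrom m) = ν := Subtype.ext_iff
  have hne : (⋂ m, F m).Nonempty := by
    -- The sets `F m` are closed in a compact space, non-empty, and decreasing because `ν` is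
    -- shift-invariant.
    refine IsCompact.nonempty_iInter_of_sequence_nonempty_isCompact_isClosed F ?_ ?_ ?_ ?_
    · intro m P hP
      rw [hF] at hP ⊢
      have : (tailFrom m : (ℤ → A) → ℕ → A) = shiftMap ∘ tailFrom (m + 1) :=
        funext fun x => (shiftMap_tailFrom_succ m x).symm
      rw [this, ← Measure.map_map measurable_shiftMap (measurable_tailFrom _), hP, hν.map_eq]
    · intro m
      -- Places `y` from position `-m` on; further left, `toNat` fills in the constant letter `y 0`.
      let s : (ℕ → A) → ℤ → A := fun y i => y (i + m).toNat
      have hs : Measurable s := measurable_pi_lambda _ fun i => measurable_pi_apply _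
      refine ⟨⟨ν.map s, Measure.isProbabilityMeasure_map hs.aemeasurable⟩, (hF _ _).2 ?_⟩
      have : tailFrom m ∘ s = id := by
        funext y k
        simp [tailFrom, s]
      rw [ProbabilityMeasure.coe_mk, Measure.map_map (measurable_tailFrom m) hs, this,
        Measure.map_id]
    · exact (isClosed_singleton.preimage
        (ProbabilityMeasure.continuous_map (continuous_tailFrom 0))).isCompact
    · exact fun m => isClosed_singleton.preimage
        (ProbabilityMeasure.continuous_map (continuous_tailFrom m))
  obtain ⟨P, hP⟩ := hne
  exact ⟨P, inferInstance, fun m => (hF m P).1 (Set.mem_iInter.1 hP m)⟩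

namespace ShiftSpace

variable {A : Type*} [TopologicalSpace A] [MeasurableSpace A]

theorem measurable_T {N : Type*} [AddMonoidWithOne N] (X : ShiftSpace N A) : Measurable X.T :=
  (measurable_shiftMap.comp measurable_subtype_coe).subtype_mk

/-- A finite measure on a one-sided shift is determined by the measures of the cylinders. -/
theorem measure_ext_of_cylinder [Countable A] [MeasurableSingletonClass A] (X : ShiftSpace ℕ A)
    {μ₁ μ₂ : Measure X.carrier} [IsFiniteMeasure μ₁]
    (h : ∀ w, μ₁ (X.cylinder w) = μ₂ (X.cylinder w)) : μ₁ = μ₂ := by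
  let r (m : ℕ) (x : X.carrier) : Fin m → A := fun k => x.1 k
  have hr (m : ℕ) : Measurable (r m) :=
    measurable_pi_lambda _ fun k => (measurable_pi_apply (k : ℕ)).comp measurable_subtype_coe
  -- Here the tower consists of the prefix maps to `Fin m → A`, whose point fibres are cylinders.
  refine measure_ext_of_tower (r := r) (φ := fun m y k => y k.castSucc) hr
    (fun m => measurable_pi_lambda _ fun k => measurable_pi_apply _) (fun m => rfl) ?_ fun m => ?_
  · change MeasurableSpace.comap _ (⨆ i, _) ≤ _
    rw [MeasurableSpace.comap_iSup]
    refine iSup_le fun i => le_trans ?_ (le_iSup _ (i + 1))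
    rw [MeasurableSpace.comap_comp]
    have : (fun x : ℕ → A => x i) ∘ Subtype.val =
      (fun y : Fin (i + 1) → A => y (Fin.last i)) ∘ r (i + 1) := rfl
    rw [this, ← MeasurableSpace.comap_comp]
    exact MeasurableSpace.comap_mono (measurable_pi_apply _).comap_le
  · refine Measure.ext_of_singleton fun w => ?_
    have hw : r m ⁻¹' {w} = X.cylinder (List.ofFn w) := by
      ext x
      change r m x = w ↔ subword x.1 0 (List.ofFn w).length = List.ofFn w
      rw [List.length_ofFn, subword, List.ofFn_inj]
      simp [r]
    rw [Measure.map_apply (hr m) (measurableSet_singleton w),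
      Measure.map_apply (hr m) (measurableSet_singleton w), hw, h]

theorem measurableSet_cylinder [Countable A] [MeasurableSingletonClass A] (X : ShiftSpace ℕ A)
    (w : List A) : MeasurableSet (X.cylinder w) := by
  have : X.cylinder w = (fun x : X.carrier => fun k : Fin w.length => x.1 k) ⁻¹' {w.get} := by
    ext x
    change List.ofFn (fun k : Fin w.length => x.1 (0 + ((k : ℕ) : ℕ))) = w ↔
      (fun k : Fin w.length => x.1 k) = w.get
    rw [← List.ofFn_inj, List.ofFn_get]
    simp
  rw [this]
  refine (measurable_pi_lambda _ fun k => ?_) (measurableSet_singleton _)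
  exact (measurable_pi_apply (k : ℕ)).comp measurable_subtype_coe

variable [DiscreteTopology A]

theorem measurable_tail (X : ShiftSpace ℕ A) (m : ℕ) : Measurable (X.tail m) :=
  ((measurable_tailFrom m).comp measurable_subtype_coe).subtype_mk

theorem measurableSpace_le_iSup_comap_tail (X : ShiftSpace ℕ A) :
    (inferInstance : MeasurableSpace X.naturalExtension.carrier) ≤
      ⨆ m, MeasurableSpace.comap (X.tail m) inferInstance := by
  refine (MeasurableSpace.comap_mono measurableSpace_pi_le_iSup_comap_tailFrom).trans ?_
  rw [MeasurableSpace.comap_iSup]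
  refine iSup_mono fun m => ?_
  rw [MeasurableSpace.comap_comp]
  have : tailFrom m ∘ (Subtype.val : X.naturalExtension.carrier → ℤ → A) =
    Subtype.val ∘ X.tail m := rfl
  rw [this, ← MeasurableSpace.comap_comp]
  exact MeasurableSpace.comap_mono le_rfl

theorem measure_ext_of_map_tail (X : ShiftSpace ℕ A) {μ₁ μ₂ : Measure X.naturalExtension.carrier}
    [IsFiniteMeasure μ₁] (h : ∀ m, μ₁.map (X.tail m) = μ₂.map (X.tail m)) : μ₁ = μ₂ :=
  measure_ext_of_tower X.measurable_tail (fun _ => X.measurable_T) X.T_comp_tail_succ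
    X.measurableSpace_le_iSup_comap_tail h

/-- A measure corresponds to `ν` if and only if all the tail maps send it to `ν`. -/
theorem isCorrespondingMeasure_iff [Countable A] [MeasurableSingletonClass A] (X : ShiftSpace ℕ A)
    {ν : Measure X.carrier} [IsProbabilityMeasure ν] (hν : MeasurePreserving X.T ν ν)
    (μ : Measure X.naturalExtension.carrier) :
    X.IsCorrespondingMeasure ν μ ↔ ∀ m, MeasurePreserving (X.tail m) μ ν := by
  constructor
  · rintro ⟨_, hT, hcyl⟩ m
    induction m with
    | zero =>
      refine ⟨X.measurable_tail 0, (X.measure_ext_of_cylinder fun w => ?_).symm⟩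
      rw [Measure.map_apply (X.measurable_tail 0) (X.measurableSet_cylinder w),
        preimage_tail_zero_cylinder, hcyl]
    -- Invariance of `μ` together with `tail (m+1) ∘ T = tail m` carries the claim from level `m` to
    -- level `m + 1`.
    | succ m ih =>
      refine ⟨X.measurable_tail _, ?_⟩
      rw [← ih.map_eq, ← X.tail_succ_comp_T m, ← Measure.map_map (X.measurable_tail _) hT.measurable,
        hT.map_eq]
  · intro h
    have hprob : IsProbabilityMeasure μ := by
      refine ⟨?_⟩
      rw [← Set.preimage_univ (f := X.tail 0),
        (h 0).measure_preimage MeasurableSet.univ.nullMeasurableSet, measure_univ]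
    refine ⟨hprob, ⟨X.naturalExtension.measurable_T, ?_⟩, fun w => ?_⟩
    · refine (X.measure_ext_of_map_tail fun m => ?_).symm
      rw [Measure.map_map (X.measurable_tail m) X.naturalExtension.measurable_T, tail_comp_T,
        (hν.comp (h m)).map_eq, (h m).map_eq]
    · rw [← preimage_tail_zero_cylinder,
        (h 0).measure_preimage (X.measurableSet_cylinder w).nullMeasurableSet]

theorem existsUnique_isCorrespondingMeasure [Finite A] [BorelSpace A] (X : ShiftSpace ℕ A)
    {ν : Measure X.carrier} [IsProbabilityMeasure ν] (hν : MeasurePreserving X.T ν ν) :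
    ∃! μ, X.IsCorrespondingMeasure ν μ := by
  have hmeas : MeasurableSet X.carrier := X.isClosed.measurableSet
  have hmeas' : MeasurableSet X.naturalExtension.carrier := X.naturalExtension.isClosed.measurableSet
  have hval := MeasurableEmbedding.subtype_coe hmeas
  have hval' := MeasurableEmbedding.subtype_coe hmeas'
  have := Measure.isProbabilityMeasure_map (μ := ν) hval.measurable.aemeasurable
  obtain ⟨P, hP, hPm⟩ := exists_measure_map_tailFrom_eq (ν.map Subtype.val) <| by
    refine ⟨measurable_shiftMap, ?_⟩
    rw [Measure.map_map measurable_shiftMap hval.measurable]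
    change ν.map (Subtype.val ∘ X.T) = _
    rw [← Measure.map_map hval.measurable X.measurable_T, hν.map_eq]
  -- Membership means that each of countably many tails lies in `X`, and each tail has law `ν`,
  -- carried by `X`.
  have hae : ∀ᵐ x ∂P, x ∈ X.naturalExtension.carrier := by
    simp only [mem_naturalExtension_iff, ae_all_iff]
    intro m
    have : ∀ᵐ y ∂(P.map (tailFrom m)), y ∈ X.carrier := by
      rw [hPm, hval.ae_map_iff]
      exact .of_forall fun y => y.2
    exact ae_of_ae_map (measurable_tailFrom m).aemeasurable this
  have hmap : (P.comap (Subtype.val : X.naturalExtension.carrier → ℤ → A)).map Subtype.val = P := by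
    rw [hval'.map_comap, Subtype.range_coe, Measure.restrict_eq_self_of_ae_mem hae]
  have hcor : X.IsCorrespondingMeasure ν (P.comap Subtype.val) := by
    refine (X.isCorrespondingMeasure_iff hν _).2 fun m => ⟨X.measurable_tail m, ?_⟩
    have h1 : ((P.comap (Subtype.val : X.naturalExtension.carrier → ℤ → A)).map (X.tail m)).map
        Subtype.val = ν.map Subtype.val := by
      rw [Measure.map_map hval.measurable (X.measurable_tail m), ← hPm m]
      change Measure.map (tailFrom m ∘ Subtype.val) _ = _
      rw [← Measure.map_map (measurable_tailFrom m) hval'.measurable, hmap]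
    rw [← hval.comap_map ν, ← h1, hval.comap_map]
  refine ⟨P.comap Subtype.val, hcor, fun μ hμ => ?_⟩
  have := hμ.isProbabilityMeasure
  refine X.measure_ext_of_map_tail fun m => ?_
  rw [((X.isCorrespondingMeasure_iff hν μ).1 hμ m).map_eq,
    ((X.isCorrespondingMeasure_iff hν _).1 hcor m).map_eq]

theorem isMeasurableEigenvalue_iff [Finite A] [BorelSpace A] (X : ShiftSpace ℕ A)
    {ν : Measure X.carrier} [IsProbabilityMeasure ν] (hν : MeasurePreserving X.T ν ν)
    {μ : Measure X.naturalExtension.carrier} (hμ : X.IsCorrespondingMeasure ν μ) (c : ℂ) :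
    X.IsMeasurableEigenvalue ν hν c ↔
      X.naturalExtension.IsMeasurableEigenvalue μ hμ.measurePreserving c := by
  have := hμ.isProbabilityMeasure
  exact hasEigenvalue_iff_of_tower hμ.measurePreserving hν
    ((X.isCorrespondingMeasure_iff hν μ).1 hμ) X.T_comp_tail_succ X.tail_succ_comp_T
    X.measurableSpace_le_iSup_comap_tail c

end ShiftSpace

theorem mainTheorem12 {A : Type*} [Finite A] [TopologicalSpace A] [DiscreteTopology A]
    [MeasurableSpace A] [BorelSpace A] (X : ShiftSpace ℕ A) (hX : X.IsMinimal) :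
    X.E = X.naturalExtension.E ∧
    (∀ c : ℂ, X.IsContinuousEigenvalue c ↔ X.naturalExtension.IsContinuousEigenvalue c) ∧
    ∀ (ν : Measure X.carrier) (_ : IsProbabilityMeasure ν) (hν : MeasurePreserving X.T ν ν),
      (∃! μ : Measure X.naturalExtension.carrier, X.IsCorrespondingMeasure ν μ) ∧
      ∀ (μ : Measure X.naturalExtension.carrier) (hμ : X.IsCorrespondingMeasure ν μ) (c : ℂ),
        X.IsMeasurableEigenvalue ν hν c ↔
          X.naturalExtension.IsMeasurableEigenvalue μ hμ.measurePreserving c := by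
  have hcont (c : ℂ) : X.IsContinuousEigenvalue c ↔ X.naturalExtension.IsContinuousEigenvalue c :=
    (ShiftSpace.isContinuousEigenvalue_naturalExtension_iff hX.T_surjective c).symm
  exact ⟨Set.ext fun t => hcont _, hcont, fun ν _ hν =>
    ⟨X.existsUnique_isCorrespondingMeasure hν, fun μ hμ c => X.isMeasurableEigenvalue_iff hν hμ c⟩⟩
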